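/- Let $d\ge 0$ and $D$ be integers with codimension $k=D-d>2$, and let $\mathcal M\subset\mathbb R^D$ be an embedded $C^2$ submanifold (without boundary) of dimension $d$. Let the data $\mathbf x$ have a probability density $p_{data}\ge 0$ with respect to the $d$-dimensional volume of $\mathcal M$, continuous and bounded on $\mathcal M$. Let $a,b:[0,1]\to\mathbb R$ be continuous, $b$ strictly increasing with $b(0)=0$, and $a(t)-1=O(b(t))$ as $t\downarrow 0$ (for example $a\equiv 1$). Let the noise level $t\in[0,1]$ have a prior probability density $p(t)$ such that the law induced on the variance $v=b(t)^2$ has a density bounded below near zero: there are $c,v_0>0$ such that every Borel set $A\subset(0,v_0)$ has probability at least $c\,|A|$. For $\mathbf u\in\mathbb R^D$ put $$p(\mathbf u\mid t)=\int_{\mathcal M}(2\pi b(t)^2)^{-D/2}\exp\Big(-\frac{\|\mathbf u-a(t)\mathbf x\|^2}{2b(t)^2}\Big)\,p_{data}(\mathbf x)\,d\mathbf x,\qquad p(t\mid\mathbf u)=\frac{p(\mathbf u\mid t)\,p(t)}{\int_0^1p(\mathbf u\mid s)\,p(s)\,ds}.$$ Then: (1) For every $\mathbf u$ with $\mathrm{dist}(\mathbf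 u,\mathcal M)>0$ the denominator is positive and finite, so that the noise posterior $p(t\mid\mathbf u)$ is a well-defined probability law on $[0,1]$. (2) If $\mathcal M$ is compact and $p_{data}>0$ on $\mathcal M$, then $p(t\mid\mathbf u)$ converges weakly to $\delta_0$ as $\mathrm{dist}(\mathbf u,\mathcal M)\to 0$, $\mathrm{dist}(\mathbf u,\mathcal M)>0$. (3) In general (with $\mathcal M$ not necessarily compact), for every nonempty compact $K\subset\mathcal M$ with $p_{data}>0$ on $K$, $p(t\mid\mathbf u)$ converges weakly to $\delta_0$ as $\mathrm{dist}(\mathbf u,K)\to 0$, $\mathrm{dist}(\mathbf u,\mathcal M)>0$. In particular ($K=\{\mathbf x_0\}$) this holds as $\mathbf u\to\mathbf x_0$ for every $\mathbf x_0\in\mathcal M$ with $p_{data}(\mathbf x_0)>0$. -/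

import Mathlib

open MeasureTheory Set Filter Topology Asymptotics
open scoped ENNReal NNReal

/-- `M` is a `d`-dimensional embedded `C²` submanifold (without boundary) of `ℝ^D`: around each of
its points there is a `C²` diffeomorphism between open subsets of `ℝ^D` which straightens `M` to the
coordinate subspace on which all coordinates of index at least `d` vanish. -/
def IsC2Submanifold {D : ℕ} (d : ℕ) (M : Set (EuclideanSpace ℝ (Fin D))) : Prop :=
  d ≤ D ∧ ∀ x ∈ M, ∃ φ : OpenPartialHomeomorph (EuclideanSpace ℝ (Fin D))
      (EuclideanSpace ℝ (Fin D)),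
    x ∈ φ.source ∧ ContDiffOn ℝ 2 φ φ.source ∧ ContDiffOn ℝ 2 φ.symm φ.target ∧
      ∀ y ∈ φ.source, y ∈ M ↔ ∀ i : Fin D, d ≤ (i : ℕ) → φ y i = 0

/-- The distribution on `M` with density `q` with respect to the `d`-dimensional volume of `M`
(the `d`-dimensional Hausdorff measure, normalized so as to be Lebesgue measure on `ℝ^d`). -/
noncomputable def dataLaw {D : ℕ} (d : ℕ) (M : Set (EuclideanSpace ℝ (Fin D)))
    (q : EuclideanSpace ℝ (Fin D) → ℝ) : Measure (EuclideanSpace ℝ (Fin D)) :=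
  ((Measure.euclideanHausdorffMeasure d : Measure (EuclideanSpace ℝ (Fin D))).restrict M).withDensity
    (fun x => ENNReal.ofReal (q x))

/-- The density at `u` of the Gaussian law on `ℝ^D` with mean `m` and covariance `v • I`. -/
noncomputable def isotropicGaussianDensity {D : ℕ} (m : EuclideanSpace ℝ (Fin D)) (v : ℝ)
    (u : EuclideanSpace ℝ (Fin D)) : ℝ :=
  (2 * Real.pi * v) ^ (-(D : ℝ) / 2) * Real.exp (-‖u - m‖ ^ 2 / (2 * v))

/-- The likelihood `p(u | t)`: the density at `u` of `a(t) x + b(t) ε`, where `x` has law `P` and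
`ε` is an independent standard Gaussian vector. -/
noncomputable def likelihood {D : ℕ} (a b : ℝ → ℝ) (P : Measure (EuclideanSpace ℝ (Fin D)))
    (u : EuclideanSpace ℝ (Fin D)) (t : ℝ) : ℝ≥0∞ :=
  ∫⁻ x, ENNReal.ofReal (isotropicGaussianDensity (a t • x) (b t ^ 2) u) ∂P

/-- The prior law on `[0, 1]` with density `p`. -/
noncomputable def priorLaw (p : ℝ → ℝ) : Measure ℝ :=
  (volume.restrict (Icc 0 1)).withDensity (fun t => ENNReal.ofReal (p t))

/-- The evidence `p(u) = ∫ p(u | t) p(t) dt`. -/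
noncomputable def evidence {D : ℕ} (a b : ℝ → ℝ) (P : Measure (EuclideanSpace ℝ (Fin D)))
    (p : ℝ → ℝ) (u : EuclideanSpace ℝ (Fin D)) : ℝ≥0∞ :=
  ∫⁻ t, likelihood a b P u t ∂(priorLaw p)

/-- The noise posterior `p(t | u) = p(u | t) p(t) / p(u)`, as a measure. It is a probability measure
exactly when the evidence is neither zero nor infinite. -/
noncomputable def posterior {D : ℕ} (a b : ℝ → ℝ) (P : Measure (EuclideanSpace ℝ (Fin D)))
    (p : ℝ → ℝ) (u : EuclideanSpace ℝ (Fin D)) : Measure ℝ :=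
  (evidence a b P p u)⁻¹ • (priorLaw p).withDensity (likelihood a b P u)

/-- On some interval `(0, v₀)` the measure `ν` dominates a positive multiple of Lebesgue measure;
for a law with a density, that density is bounded below by a positive constant on `(0, v₀)`. -/
def DensityBoundedBelowNearZero (ν : Measure ℝ) : Prop :=
  ∃ c : ℝ≥0, 0 < c ∧ ∃ v₀ : ℝ, 0 < v₀ ∧ c • volume.restrict (Ioo 0 v₀) ≤ ν

/-- The noise posterior as a point of the space of probability measures, whose topology is that of
weak convergence. -/
noncomputable def posteriorProba {D : ℕ} (a b : ℝ → ℝ) (P : Measure (EuclideanSpace ℝ (Fin D)))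
    (p : ℝ → ℝ) (u : EuclideanSpace ℝ (Fin D)) (h : IsProbabilityMeasure (posterior a b P p u)) :
    ProbabilityMeasure ℝ :=
  ⟨posterior a b P p u, h⟩

/-! The posterior mass of noise levels `t ≥ δ` is at most a constant depending on `δ` divided by the
evidence, because the likelihood is bounded where `b t` is bounded below (`posterior_le`). So
concentration at `0` reduces to blow-up of the evidence. Blow-up is a scaling count
(`exists_le_evidence`). Let `u` be at distance `r` from a point `x₀` of `M` with positive density.
Variances in `(r², 2r²)` have prior mass at least of order `r²`. At such a level the Gaussian is at
least of order `r^(-D)` on the ball of radius `b t` about `x₀`, which has data mass at least of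
order `r^d` (`IsC2Submanifold.exists_le_dataLaw_ball`). The evidence is thus at least of order
`r^(d+2-D)`, hence of order `1/r` for small `r`, since the codimension exceeds 2. Finiteness off the
closure of `M` holds because a Gaussian density, seen from a fixed distance to its mean, is bounded
uniformly in the variance (`exists_likelihood_le`). -/

/-! ### Volume of small balls in a submanifold. -/

/-- The projection of `ℝ^D` onto its first `d` coordinates. -/
noncomputable def coordProj {d D : ℕ} (h : d ≤ D) :
    EuclideanSpace ℝ (Fin D) →L[ℝ] EuclideanSpace ℝ (Fin d) :=
  LinearMap.toContinuousLinearMap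
    { toFun := fun z => WithLp.toLp 2 fun i => z (Fin.castLE h i)
      map_add' := fun _ _ => by ext; simp
      map_smul' := fun _ _ => by ext; simp }

/-- The inclusion of `ℝ^d` into `ℝ^D` as the first `d` coordinates. -/
noncomputable def coordIncl (d D : ℕ) :
    EuclideanSpace ℝ (Fin d) →L[ℝ] EuclideanSpace ℝ (Fin D) :=
  LinearMap.toContinuousLinearMap
    { toFun := fun z => WithLp.toLp 2 fun i => if h : (i : ℕ) < d then z ⟨i, h⟩ else 0
      map_add' := fun _ _ => by ext i; by_cases h : (i : ℕ) < d <;> simp [h]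
      map_smul' := fun _ _ => by ext i; by_cases h : (i : ℕ) < d <;> simp [h] }

theorem coordProj_coordIncl {d D : ℕ} (h : d ≤ D) (w : EuclideanSpace ℝ (Fin d)) :
    coordProj h (coordIncl d D w) = w := by
  ext i
  simp [coordProj, coordIncl]

theorem coordIncl_apply_of_le {d D : ℕ} (w : EuclideanSpace ℝ (Fin d)) {i : Fin D}
    (hi : d ≤ (i : ℕ)) : coordIncl d D w i = 0 := by
  simp [coordIncl, hi]

/-- In a chart `M` is a common zero set of continuous coordinates. Being locally closed makes `M`
Borel. -/
theorem IsC2Submanifold.isLocallyClosed {d D : ℕ} {M : Set (EuclideanSpace ℝ (Fin D))}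
    (hM : IsC2Submanifold d M) : IsLocallyClosed M := by
  refine ((isLocallyClosed_tfae M).out 0 2).2 fun x hx => ?_
  obtain ⟨φ, hxφ, hφ, -, hφM⟩ := hM.2 x hx
  refine ⟨φ.source, φ.open_source.mem_nhds hxφ, ?_⟩
  have hcont : Continuous fun y : φ.source => φ y :=
    continuousOn_iff_continuous_domRestrict.1 φ.continuousOn
  have heq : (Subtype.val ⁻¹' M : Set φ.source) =
      ⋂ (i : Fin D) (_ : d ≤ (i : ℕ)), {y : φ.source | φ y i = 0} := by
    ext y
    simp [hφM y y.2]
  rw [heq]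
  exact isClosed_iInter fun i => isClosed_iInter fun _ =>
    isClosed_eq ((EuclideanSpace.proj (𝕜 := ℝ) i).continuous.comp hcont) continuous_const

/-- The Lipschitz image bound for the normalized Hausdorff measure. -/
theorem LipschitzOnWith.euclideanHausdorffMeasure_image_le {X Y : Type*} [EMetricSpace X]
    [EMetricSpace Y] [MeasurableSpace X] [BorelSpace X] [MeasurableSpace Y] [BorelSpace Y]
    {K : ℝ≥0} {f : X → Y} {s : Set X} (h : LipschitzOnWith K f s) (d : ℕ) :
    Measure.euclideanHausdorffMeasure d (f '' s) ≤
      (K : ℝ≥0∞) ^ d * Measure.euclideanHausdorffMeasure d s := by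
  have := h.hausdorffMeasure_image_le (d := d) (by positivity)
  rw [ENNReal.rpow_natCast] at this
  simp only [Measure.euclideanHausdorffMeasure_def, Measure.smul_apply]
  rw [mul_smul_comm]
  gcongr

/-- Lipschitz maps increase Hausdorff measure by a bounded factor, and the first `d` chart
coordinates map a small piece of `M` onto a set containing a Euclidean ball of comparable radius.
Only one-sided bounds are needed, so no area formula enters. -/
theorem IsC2Submanifold.exists_le_measure_inter_ball {d D : ℕ}
    {M : Set (EuclideanSpace ℝ (Fin D))} (hM : IsC2Submanifold d M)
    {x₀ : EuclideanSpace ℝ (Fin D)} (hx₀ : x₀ ∈ M) :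
    ∃ c : ℝ, 0 < c ∧ ∃ ε : ℝ, 0 < ε ∧ ∀ r ∈ Ioo 0 ε, ENNReal.ofReal (c * r ^ d) ≤
      (Measure.euclideanHausdorffMeasure d : Measure (EuclideanSpace ℝ (Fin D)))
        (M ∩ Metric.ball x₀ r) := by
  obtain ⟨hdD, hM⟩ := hM
  obtain ⟨φ, hxφ, hφ, hψ, hφM⟩ := hM x₀ hx₀
  have hφx : φ x₀ ∈ φ.target := φ.map_source hxφ
  set f : EuclideanSpace ℝ (Fin D) → EuclideanSpace ℝ (Fin d) := fun x => coordProj hdD (φ x)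
  set g : EuclideanSpace ℝ (Fin d) → EuclideanSpace ℝ (Fin D) :=
    fun w => φ.symm (φ x₀ + coordIncl d D w)
  have hg0 : g 0 = x₀ := by simp [g, φ.left_inv hxφ]
  have hf : ContDiffAt ℝ 1 f x₀ :=
    (coordProj hdD).contDiff.contDiffAt.comp x₀
      ((hφ.contDiffAt (φ.open_source.mem_nhds hxφ)).of_le (by norm_num))
  have hg : ContDiffAt ℝ 1 g 0 := by
    have h1 : ContDiffAt ℝ 1 φ.symm (φ x₀ + coordIncl d D 0) := by
      rw [map_zero, add_zero]
      exact (hψ.contDiffAt (φ.open_target.mem_nhds hφx)).of_le (by norm_num)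
    exact h1.comp (0 : EuclideanSpace ℝ (Fin d))
      ((contDiff_const.add (coordIncl d D).contDiff).contDiffAt)
  obtain ⟨K, U, hU, hK⟩ := hf.exists_lipschitzOnWith
  obtain ⟨L, V, hV, hL⟩ := hg.exists_lipschitzOnWith
  have htgt : ∀ᶠ w in 𝓝 (0 : EuclideanSpace ℝ (Fin d)), φ x₀ + coordIncl d D w ∈ φ.target := by
    have : ContinuousAt (fun w => φ x₀ + coordIncl d D w) 0 := by fun_prop
    exact this.eventually_mem (φ.open_target.mem_nhds (by simpa using hφx))
  obtain ⟨ε₁, hε₁, h₁⟩ := Metric.mem_nhds_iff.1 hU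
  obtain ⟨ε₂, hε₂, h₂⟩ := Metric.mem_nhds_iff.1 (inter_mem hV htgt)
  -- The Lipschitz constants may vanish; adding 1 allows division by them.
  set L' : ℝ := L + 1
  have hL' : 0 < L' := by positivity
  set K' : ℝ := K + 1
  have hK' : 0 < K' := by positivity
  set β : ℝ := (volume (Metric.ball (0 : EuclideanSpace ℝ (Fin d)) 1)).toReal
  have hβ : 0 < β := ENNReal.toReal_pos (Metric.measure_ball_pos _ _ one_pos).ne'
    measure_ball_lt_top.ne
  refine ⟨β / (K' * L') ^ d, by positivity, min ε₁ (ε₂ * L'), by positivity, ?_⟩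
  rintro r ⟨hr, hrε⟩
  have hr1 : r < ε₁ := hrε.trans_le (min_le_left _ _)
  have hr2 : r / L' < ε₂ := by rw [div_lt_iff₀ hL']; exact hrε.trans_le (min_le_right _ _)
  -- The inverse chart restricted to the coordinate subspace, `g`, is a Lipschitz section of `f`
  -- with values in `M`.
  have hsub : Metric.ball (f x₀) (r / L') ⊆ f '' (M ∩ Metric.ball x₀ r) := by
    intro y hy
    have hw : y - f x₀ ∈ Metric.ball (0 : EuclideanSpace ℝ (Fin d)) (r / L') := by
      simpa [dist_eq_norm] using hy
    have hw2 := h₂ (Metric.ball_subset_ball hr2.le hw)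
    have hφg : φ (g (y - f x₀)) = φ x₀ + coordIncl d D (y - f x₀) := φ.right_inv hw2.2
    refine ⟨g (y - f x₀), ⟨?_, ?_⟩, ?_⟩
    · rw [hφM _ (φ.map_target hw2.2), hφg]
      intro i hi
      simp [coordIncl_apply_of_le _ hi, (hφM x₀ hxφ).1 hx₀ i hi]
    · have := hL.dist_le_mul _ hw2.1 _ (mem_of_mem_nhds hV)
      rw [hg0] at this
      rw [Metric.mem_ball] at hw ⊢
      calc _ ≤ L * dist (y - f x₀) 0 := this
        _ ≤ L' * dist (y - f x₀) 0 := by gcongr; simp [L']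
        _ < L' * (r / L') := by gcongr
        _ = r := by field_simp
    · change coordProj hdD (φ _) = y
      rw [hφg, map_add, coordProj_coordIncl]
      simp [f]
  have hmain := ((hK.mono (inter_subset_right.trans
    ((Metric.ball_subset_ball hr1.le).trans h₁)) : LipschitzOnWith K f
      (M ∩ Metric.ball x₀ r))).euclideanHausdorffMeasure_image_le d
  have hball := measure_mono hsub (μ := Measure.euclideanHausdorffMeasure d)
  rw [EuclideanSpace.euclideanHausdorffMeasure_eq_volume] at hball hmain
  rw [Measure.addHaar_ball_of_pos _ _ (by positivity), finrank_euclideanSpace_fin,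
    ← ENNReal.ofReal_toReal (measure_ball_lt_top (μ := volume)).ne,
    ← ENNReal.ofReal_mul (by positivity)] at hball
  have hKle : (K : ℝ≥0∞) ^ d ≤ ENNReal.ofReal (K' ^ d) := by
    rw [ENNReal.ofReal_pow hK'.le]
    gcongr
    rw [← ENNReal.ofReal_coe_nnreal]
    exact ENNReal.ofReal_le_ofReal (by simp [K'])
  have hfin := hball.trans (hmain.trans (mul_le_mul_left hKle _))
  have hne : ENNReal.ofReal (K' ^ d) ≠ 0 := by simpa using pow_pos hK' d
  rw [← ENNReal.mul_le_mul_iff_right hne ENNReal.ofReal_ne_top,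
    ← ENNReal.ofReal_mul (by positivity)]
  refine le_of_eq_of_le (congrArg _ ?_) hfin
  change _ = (r / L') ^ d * β
  rw [mul_pow, div_pow]
  field_simp

theorem IsC2Submanifold.exists_le_dataLaw_ball {d D : ℕ}
    {M : Set (EuclideanSpace ℝ (Fin D))} (hM : IsC2Submanifold d M)
    {q : EuclideanSpace ℝ (Fin D) → ℝ} (hq : ContinuousOn q M)
    {x₀ : EuclideanSpace ℝ (Fin D)} (hx₀ : x₀ ∈ M) (hqx₀ : 0 < q x₀) :
    ∃ c : ℝ, 0 < c ∧ ∃ ε : ℝ, 0 < ε ∧ ∀ r ∈ Ioo 0 ε, ENNReal.ofReal (c * r ^ d) ≤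
      dataLaw d M q (Metric.ball x₀ r) := by
  obtain ⟨c, hc, ε, hε, h⟩ := hM.exists_le_measure_inter_ball hx₀
  have hev : ∀ᶠ x in 𝓝[M] x₀, q x₀ / 2 < q x :=
    (hq x₀ hx₀).eventually (lt_mem_nhds (by linarith))
  obtain ⟨η, hη, hball⟩ := Metric.mem_nhdsWithin_iff.1 hev
  refine ⟨q x₀ / 2 * c, by positivity, min ε η, by positivity, ?_⟩
  rintro r ⟨hr, hrε⟩
  have hmeas : MeasurableSet (Metric.ball x₀ r ∩ M) := by
    obtain ⟨A, B, hA, hB, hAB⟩ := hM.isLocallyClosed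
    rw [hAB]
    exact Metric.isOpen_ball.measurableSet.inter (hA.measurableSet.inter hB.measurableSet)
  rw [dataLaw, withDensity_apply _ Metric.isOpen_ball.measurableSet,
    Measure.restrict_restrict Metric.isOpen_ball.measurableSet]
  calc ENNReal.ofReal (q x₀ / 2 * c * r ^ d)
      = ENNReal.ofReal (q x₀ / 2) * ENNReal.ofReal (c * r ^ d) := by
        rw [← ENNReal.ofReal_mul (by positivity), mul_assoc]
    _ ≤ ENNReal.ofReal (q x₀ / 2) * Measure.euclideanHausdorffMeasure d (Metric.ball x₀ r ∩ M) := by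
        gcongr
        rw [inter_comm]
        exact h r ⟨hr, hrε.trans_le (min_le_left _ _)⟩
    _ = ∫⁻ _ in Metric.ball x₀ r ∩ M, ENNReal.ofReal (q x₀ / 2)
          ∂(Measure.euclideanHausdorffMeasure d) := (setLIntegral_const _ _).symm
    _ ≤ _ := setLIntegral_mono' hmeas fun x hx => ENNReal.ofReal_le_ofReal
        (le_of_lt (hball ⟨Metric.ball_subset_ball (hrε.le.trans (min_le_right _ _)) hx.1, hx.2⟩))

/-! ### Bounds on the Gaussian density. -/

section Gaussian

variable {D : ℕ}

theorem isotropicGaussianDensity_pos {m u : EuclideanSpace ℝ (Fin D)} {v : ℝ} (hv : 0 < v) :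
    0 < isotropicGaussianDensity m v u := by
  unfold isotropicGaussianDensity
  positivity

theorem isotropicGaussianDensity_le {m u : EuclideanSpace ℝ (Fin D)} {v v₁ : ℝ} (hv₁ : 0 < v₁)
    (hv : v₁ ≤ v) :
    isotropicGaussianDensity m v u ≤ (2 * Real.pi * v₁) ^ (-(D : ℝ) / 2) := by
  have hv0 : 0 < v := hv₁.trans_le hv
  unfold isotropicGaussianDensity
  calc _ ≤ (2 * Real.pi * v) ^ (-(D : ℝ) / 2) * 1 := by
        gcongr
        rw [Real.exp_le_one_iff, neg_div]
        have : 0 ≤ ‖u - m‖ ^ 2 / (2 * v) := by positivity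
        linarith
    _ ≤ _ := by
        rw [mul_one]
        apply Real.rpow_le_rpow_of_nonpos (by positivity) (by gcongr)
        have : (0 : ℝ) ≤ D := by positivity
        linarith

/-- Away from its mean, the Gaussian density is bounded uniformly in the variance. -/
theorem isotropicGaussianDensity_le_of_le_norm {m u : EuclideanSpace ℝ (Fin D)} {v s : ℝ}
    (hv : 0 < v) (hs : 0 < s) (hsu : s ≤ ‖u - m‖) :
    isotropicGaussianDensity m v u ≤ ((D + 1 : ℝ) / (2 * Real.pi * s ^ 2)) ^ ((D : ℝ) / 2) := by
  -- The inequality `x ≤ exp x` trades the factor `v^(-D/2)` for part of the Gaussian decay. Using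
  -- `D + 1` instead of `D` covers `D = 0` and leaves a nonpositive exponent.
  have hD : (0 : ℝ) < D + 1 := by positivity
  have h1 : s ^ 2 / (2 * v) / ((D + 1) / 2) ≤ Real.exp (s ^ 2 / (2 * v) / ((D + 1) / 2)) :=
    (by linarith : _ ≤ s ^ 2 / (2 * v) / ((D + 1) / 2) + 1).trans (Real.add_one_le_exp _)
  have h2 : (2 * Real.pi * v)⁻¹ ≤
      ((D + 1 : ℝ) / (2 * Real.pi * s ^ 2)) * Real.exp (s ^ 2 / (v * (D + 1))) := by
    have e1 : s ^ 2 / (2 * v) / ((D + 1) / 2) = s ^ 2 / (v * (D + 1)) := by field_simp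
    rw [e1] at h1
    calc (2 * Real.pi * v)⁻¹
        = ((D + 1 : ℝ) / (2 * Real.pi * s ^ 2)) * (s ^ 2 / (v * (D + 1))) := by field_simp
      _ ≤ _ := by gcongr
  unfold isotropicGaussianDensity
  rw [neg_div, Real.rpow_neg (by positivity), ← Real.inv_rpow (by positivity)]
  calc _ ≤ (((D + 1 : ℝ) / (2 * Real.pi * s ^ 2)) * Real.exp (s ^ 2 / (v * (D + 1))))
            ^ ((D : ℝ) / 2) * Real.exp (-s ^ 2 / (2 * v)) := by
        gcongr
    _ = ((D + 1 : ℝ) / (2 * Real.pi * s ^ 2)) ^ ((D : ℝ) / 2) *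
          Real.exp (s ^ 2 / (v * (D + 1)) * (D / 2) + -s ^ 2 / (2 * v)) := by
        rw [Real.mul_rpow (by positivity) (by positivity), ← Real.exp_mul, Real.exp_add, mul_assoc]
    _ ≤ _ := by
        apply mul_le_of_le_one_right (by positivity)
        rw [Real.exp_le_one_iff]
        have : s ^ 2 / (v * (D + 1)) * (D / 2) + -s ^ 2 / (2 * v) =
          -(s ^ 2 / (2 * v * (D + 1))) := by field_simp; ring
        rw [this, neg_nonpos]
        positivity

theorem le_isotropicGaussianDensity {m u : EuclideanSpace ℝ (Fin D)} {b β A : ℝ}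
    (hb : 0 < b) (hbβ : b ≤ β) (hu : ‖u - m‖ ≤ b * A) :
    (2 * Real.pi * β ^ 2) ^ (-(D : ℝ) / 2) * Real.exp (-A ^ 2 / 2) ≤
      isotropicGaussianDensity m (b ^ 2) u := by
  unfold isotropicGaussianDensity
  have h0 : -(D : ℝ) / 2 ≤ 0 := by
    have : (0 : ℝ) ≤ D := by positivity
    linarith
  have h1 : (2 * Real.pi * β ^ 2) ^ (-(D : ℝ) / 2) ≤ (2 * Real.pi * b ^ 2) ^ (-(D : ℝ) / 2) :=
    Real.rpow_le_rpow_of_nonpos (by positivity) (by gcongr) h0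
  gcongr ?_ * Real.exp ?_
  have h2 : ‖u - m‖ ^ 2 ≤ (b * A) ^ 2 := by gcongr
  rw [div_le_div_iff₀ (by positivity) (by positivity)]
  nlinarith

theorem measurable_isotropicGaussianDensity (u : EuclideanSpace ℝ (Fin D)) :
    Measurable fun z : EuclideanSpace ℝ (Fin D) × ℝ => isotropicGaussianDensity z.1 z.2 u := by
  unfold isotropicGaussianDensity
  fun_prop

end Gaussian

/-! ### Measurability and bounds for the likelihood. -/

section Likelihood

variable {D : ℕ} {a b p : ℝ → ℝ} {P : Measure (EuclideanSpace ℝ (Fin D))}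

theorem priorLaw_absolutelyContinuous (p : ℝ → ℝ) :
    priorLaw p ≪ volume.restrict (Icc (0 : ℝ) 1) :=
  withDensity_absolutelyContinuous _ _

theorem ae_priorLaw_mem_Ioc (p : ℝ → ℝ) : ∀ᵐ t ∂priorLaw p, t ∈ Ioc (0 : ℝ) 1 := by
  refine (priorLaw_absolutelyContinuous p).ae_le ?_
  rw [← restrict_Ioc_eq_restrict_Icc]
  exact ae_restrict_mem measurableSet_Ioc

theorem pos_of_strictMonoOn (hb_mono : StrictMonoOn b (Icc 0 1)) (hb_zero : b 0 = 0) {t : ℝ}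
    (ht : t ∈ Ioc (0 : ℝ) 1) : 0 < b t := by
  rw [← hb_zero]
  exact hb_mono (by simp) ⟨ht.1.le, ht.2⟩ ht.1

theorem aemeasurable_likelihood [SFinite P] (ha : ContinuousOn a (Icc 0 1))
    (hb : ContinuousOn b (Icc 0 1)) (u : EuclideanSpace ℝ (Fin D)) :
    AEMeasurable (likelihood a b P u) (priorLaw p) := by
  have ha' : AEMeasurable a (volume.restrict (Icc (0 : ℝ) 1)) := ha.aemeasurable measurableSet_Icc
  have hb' : AEMeasurable b (volume.restrict (Icc (0 : ℝ) 1)) := hb.aemeasurable measurableSet_Icc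
  refine AEMeasurable.mono_ac ?_ (priorLaw_absolutelyContinuous p)
  -- The schedule is controlled only on `[0, 1]`, so measurable versions of `a` and `b` are
  -- substituted to make the integrand jointly measurable.
  refine ⟨likelihood (ha'.mk a) (hb'.mk b) P u, ?_, ?_⟩
  · have h1 := ha'.measurable_mk
    have h2 := hb'.measurable_mk
    have h : Measurable fun z : ℝ × EuclideanSpace ℝ (Fin D) =>
        ENNReal.ofReal (isotropicGaussianDensity (ha'.mk a z.1 • z.2) (hb'.mk b z.1 ^ 2) u) :=
      ((measurable_isotropicGaussianDensity u).comp
        (((h1.comp measurable_fst).smul measurable_snd).prodMk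
          ((h2.comp measurable_fst).pow_const 2))).ennreal_ofReal
    exact h.lintegral_prod_right'
  · filter_upwards [ha'.ae_eq_mk, hb'.ae_eq_mk] with t h1 h2
    simp only [likelihood, h1, h2]

theorem likelihood_pos [NeZero P] (u : EuclideanSpace ℝ (Fin D)) {t : ℝ} (ht : 0 < b t) :
    0 < likelihood a b P u t := by
  unfold likelihood
  rw [lintegral_pos_iff_support]
  · have : (Function.support fun x =>
        ENNReal.ofReal (isotropicGaussianDensity (a t • x) (b t ^ 2) u)) = univ := by
      ext x
      simpa using isotropicGaussianDensity_pos (by positivity)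
    rw [this]
    exact (Measure.measure_univ_pos).2 (NeZero.ne P)
  · exact ((measurable_isotropicGaussianDensity u).comp
      ((measurable_id.const_smul (a t)).prodMk measurable_const)).ennreal_ofReal

theorem likelihood_le [IsProbabilityMeasure P] (u : EuclideanSpace ℝ (Fin D)) {t β : ℝ}
    (hβ : 0 < β) (ht : β ≤ b t) :
    likelihood a b P u t ≤ ENNReal.ofReal ((2 * Real.pi * β ^ 2) ^ (-(D : ℝ) / 2)) := by
  unfold likelihood
  calc _ ≤ ∫⁻ _, ENNReal.ofReal ((2 * Real.pi * β ^ 2) ^ (-(D : ℝ) / 2)) ∂P :=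
        lintegral_mono fun x => ENNReal.ofReal_le_ofReal
          (isotropicGaussianDensity_le (by positivity) (by gcongr))
    _ = _ := by simp

/-- The likelihood is bounded in `t`, for each fixed `u` away from the support of the data. -/
theorem exists_likelihood_le [IsProbabilityMeasure P] {M : Set (EuclideanSpace ℝ (Fin D))}
    (hPM : ∀ᵐ x ∂P, x ∈ M) (hb_mono : StrictMonoOn b (Icc 0 1)) (hb_zero : b 0 = 0)
    (ha : Tendsto a (𝓝[>] 0) (𝓝 1)) {u : EuclideanSpace ℝ (Fin D)}
    (hu : 0 < Metric.infDist u M) :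
    ∃ B : ℝ≥0∞, B ≠ ∞ ∧ ∀ t ∈ Ioc (0 : ℝ) 1, likelihood a b P u t ≤ B := by
  set r := Metric.infDist u M
  -- Points with `‖x‖ > R` are sent by `a t > 1/2` beyond norm `‖u‖ + 1`, hence at distance at least
  -- 1 from `u`. Points with `‖x‖ ≤ R` move by at most `r / 2`, by the choice of `η`.
  set R := 2 * (‖u‖ + 1)
  have hR : 0 < R := by positivity
  set η := min (1 / 2) (r / (2 * R))
  have hη : 0 < η := by positivity
  set s := min 1 (r / 2)
  have hs : 0 < s := by positivity
  obtain ⟨t₀, ht₀, hat⟩ : ∃ t₀ > 0, ∀ t ∈ Ioo (0 : ℝ) t₀, |a t - 1| < η := by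
    have := ha (Metric.ball_mem_nhds 1 hη)
    obtain ⟨t₀, h0, h⟩ := mem_nhdsGT_iff_exists_Ioo_subset.1 (mem_map.1 this)
    exact ⟨t₀, h0, fun t ht => by simpa [Real.dist_eq] using h ht⟩
  set t₁ := min t₀ 1
  have ht₁ : t₁ ∈ Ioc (0 : ℝ) 1 := ⟨by positivity, min_le_right _ _⟩
  have hbt₁ := pos_of_strictMonoOn hb_mono hb_zero ht₁
  refine ⟨max (ENNReal.ofReal ((2 * Real.pi * b t₁ ^ 2) ^ (-(D : ℝ) / 2)))
    (ENNReal.ofReal (((D + 1 : ℝ) / (2 * Real.pi * s ^ 2)) ^ ((D : ℝ) / 2))),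
    by simp, fun t ht => ?_⟩
  rcases le_or_gt t₁ t with h | h
  · exact (likelihood_le u hbt₁ (hb_mono.monotoneOn ⟨ht₁.1.le, ht₁.2⟩ ⟨ht.1.le, ht.2⟩ h)).trans
      (le_max_left _ _)
  · refine le_trans ?_ (le_max_right _ _)
    have hbt := pos_of_strictMonoOn hb_mono hb_zero ht
    have hη' := hat t ⟨ht.1, h.trans_le (min_le_left _ _)⟩
    have hfar : ∀ x ∈ M, s ≤ ‖u - a t • x‖ := by
      intro x hx
      rcases le_or_gt ‖x‖ R with hxR | hxR
      · have h1 : r ≤ ‖u - x‖ := by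
          rw [← dist_eq_norm]
          exact Metric.infDist_le_dist_of_mem hx
        have h2 : ‖u - x‖ ≤ ‖u - a t • x‖ + |a t - 1| * ‖x‖ := by
          calc ‖u - x‖ = ‖(u - a t • x) + (a t - 1) • x‖ := by congr 1; module
            _ ≤ _ := (norm_add_le _ _).trans (by rw [norm_smul, Real.norm_eq_abs])
        have h3 : |a t - 1| * ‖x‖ ≤ r / (2 * R) * R := by
          gcongr
          exact hη'.le.trans (min_le_right _ _)
        have h4 : r / (2 * R) * R = r / 2 := by field_simp
        have h5 : s ≤ r / 2 := min_le_right _ _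
        linarith
      · have h1 : 1 / 2 < a t := by
          have := (abs_lt.1 (hη'.trans_le (min_le_left _ _))).1
          linarith
        have h2 : ‖a t • x‖ ≤ ‖u - a t • x‖ + ‖u‖ := by
          calc ‖a t • x‖ = ‖u - (u - a t • x)‖ := by congr 1; module
            _ ≤ _ := (norm_sub_le _ _).trans (by rw [add_comm])
        rw [norm_smul, Real.norm_eq_abs, abs_of_pos (by linarith)] at h2
        have h3 : 1 / 2 * R ≤ a t * ‖x‖ := by gcongr
        have h4 : 1 / 2 * R = ‖u‖ + 1 := by simp only [R]; ring
        have h5 : s ≤ 1 := min_le_left _ _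
        linarith
    unfold likelihood
    calc _ ≤ ∫⁻ _, ENNReal.ofReal
            (((D + 1 : ℝ) / (2 * Real.pi * s ^ 2)) ^ ((D : ℝ) / 2)) ∂P := by
          apply lintegral_mono_ae
          filter_upwards [hPM] with x hx
          exact ENNReal.ofReal_le_ofReal
            (isotropicGaussianDensity_le_of_le_norm (by positivity) hs (hfar x hx))
      _ = _ := by simp

/-- The likelihood of a point `u` at distance at most `b t` from `x₀`. -/
theorem le_likelihood {x₀ u : EuclideanSpace ℝ (Fin D)} {t β C w : ℝ} (hbt : 0 < b t)
    (hbt1 : b t ≤ 1) (hbβ : b t ≤ β) (hC : 0 ≤ C) (ha : |a t - 1| ≤ C * b t)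
    (hu : ‖u - x₀‖ ≤ b t) (hP : ENNReal.ofReal w ≤ P (Metric.ball x₀ (b t))) :
    ENNReal.ofReal ((2 * Real.pi * β ^ 2) ^ (-(D : ℝ) / 2) *
      Real.exp (-(2 + C * (‖x₀‖ + 1)) ^ 2 / 2) * w) ≤ likelihood a b P u t := by
  -- In units of `b t`: one for `u` to `x₀`, one for `x₀` to `x`, and the rest for the drift `(a t -
  -- 1) • x`.
  set A := 2 + C * (‖x₀‖ + 1)
  set G := (2 * Real.pi * β ^ 2) ^ (-(D : ℝ) / 2) * Real.exp (-A ^ 2 / 2)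
  have hG : 0 ≤ G := by positivity
  have hnear : ∀ x ∈ Metric.ball x₀ (b t), ‖u - a t • x‖ ≤ b t * A := by
    intro x hx
    rw [Metric.mem_ball, dist_eq_norm] at hx
    have h1 : ‖x‖ ≤ ‖x₀‖ + 1 := by
      calc ‖x‖ = ‖x₀ + (x - x₀)‖ := by congr 1; module
        _ ≤ ‖x₀‖ + ‖x - x₀‖ := norm_add_le _ _
        _ ≤ _ := by linarith
    calc ‖u - a t • x‖ = ‖(u - x₀) - (x - x₀) - (a t - 1) • x‖ := by congr 1; module
      _ ≤ ‖u - x₀‖ + ‖x - x₀‖ + ‖(a t - 1) • x‖ :=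
        (norm_sub_le _ _).trans (add_le_add_left (norm_sub_le _ _) _)
      _ ≤ b t + b t + C * b t * (‖x₀‖ + 1) := by
        rw [norm_smul, Real.norm_eq_abs]
        gcongr
      _ = b t * A := by simp only [A]; ring
  unfold likelihood
  calc ENNReal.ofReal (G * w) = ENNReal.ofReal G * ENNReal.ofReal w := ENNReal.ofReal_mul hG
    _ ≤ ENNReal.ofReal G * P (Metric.ball x₀ (b t)) := by gcongr
    _ = ∫⁻ _ in Metric.ball x₀ (b t), ENNReal.ofReal G ∂P := (setLIntegral_const _ _).symm
    _ ≤ ∫⁻ x in Metric.ball x₀ (b t),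
          ENNReal.ofReal (isotropicGaussianDensity (a t • x) (b t ^ 2) u) ∂P :=
        setLIntegral_mono' Metric.isOpen_ball.measurableSet fun x hx =>
          ENNReal.ofReal_le_ofReal (le_isotropicGaussianDensity hbt hbβ (hnear x hx))
    _ ≤ _ := setLIntegral_le_lintegral _ _

end Likelihood

/-! ### Blow-up of the evidence and concentration of the posterior. -/

section Posterior

variable {D : ℕ} {a b p : ℝ → ℝ} {P : Measure (EuclideanSpace ℝ (Fin D))}

theorem le_priorLaw_of_le_map (hb : ContinuousOn b (Icc 0 1)) {c : ℝ≥0} {v₀ : ℝ}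
    (h : c • volume.restrict (Ioo 0 v₀) ≤ (priorLaw p).map (fun t => b t ^ 2)) {x y : ℝ}
    (hx : 0 ≤ x) (hy : y ≤ v₀) :
    ENNReal.ofReal (c * (y - x)) ≤ priorLaw p (Icc 0 1 ∩ b ⁻¹' {s | s ^ 2 ∈ Ioo x y}) := by
  have hae : AEMeasurable (fun t => b t ^ 2) (priorLaw p) :=
    ((hb.aemeasurable measurableSet_Icc).mono_ac (priorLaw_absolutelyContinuous p)).pow_const 2
  have h1 := Measure.le_iff'.1 h (Ioo x y)
  rw [Measure.map_apply_of_aemeasurable hae measurableSet_Ioo, Measure.smul_apply,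
    Measure.restrict_apply measurableSet_Ioo,
    inter_eq_left.2 (Ioo_subset_Ioo hx hy), Real.volume_Ioo] at h1
  calc ENNReal.ofReal (c * (y - x)) = c • ENNReal.ofReal (y - x) := by
        rw [ENNReal.ofReal_mul c.coe_nonneg, ENNReal.ofReal_coe_nnreal]; rfl
    _ ≤ _ := h1
    _ ≤ _ := by
      apply measure_mono_ae
      filter_upwards [ae_priorLaw_mem_Ioc p] with t ht hts
      exact ⟨⟨ht.1.le, ht.2⟩, hts⟩

/-- The evidence blows up at a point near which the data law is at least `d`-dimensional. -/
theorem exists_le_evidence {d : ℕ} (hcodim : d + 2 < D) (hb : ContinuousOn b (Icc 0 1))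
    (hb_mono : StrictMonoOn b (Icc 0 1)) (hb_zero : b 0 = 0)
    (hab : (fun t => a t - 1) =O[𝓝[>] 0] b)
    (hp_low : DensityBoundedBelowNearZero ((priorLaw p).map (fun t => b t ^ 2)))
    {x₀ : EuclideanSpace ℝ (Fin D)}
    (hP : ∃ c : ℝ, 0 < c ∧ ∃ ε : ℝ, 0 < ε ∧ ∀ r ∈ Ioo 0 ε,
      ENNReal.ofReal (c * r ^ d) ≤ P (Metric.ball x₀ r)) :
    ∃ c : ℝ, 0 < c ∧ ∃ ε : ℝ, 0 < ε ∧ ∀ u, u ≠ x₀ → ‖u - x₀‖ < ε →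
      ENNReal.ofReal (c / ‖u - x₀‖) ≤ evidence a b P p u := by
  obtain ⟨c₁, hc₁, ε₁, hε₁, hP⟩ := hP
  obtain ⟨c₂, hc₂, v₀, hv₀, hlow⟩ := hp_low
  obtain ⟨C, hC, hab⟩ := hab.exists_pos
  obtain ⟨t₀, ht₀, hat⟩ := mem_nhdsGT_iff_exists_Ioo_subset.1 hab.bound
  simp only [mem_Ioi] at ht₀
  set t₁ := min (t₀ / 2) 1
  have ht₁ : t₁ ∈ Ioc (0 : ℝ) 1 := ⟨by positivity, min_le_right _ _⟩
  have ht₁₀ : t₁ < t₀ := (min_le_left _ _).trans_lt (by linarith)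
  have hbt₁ := pos_of_strictMonoOn hb_mono hb_zero ht₁
  set E := Real.exp (-(2 + C * (‖x₀‖ + 1)) ^ 2 / 2)
  set F := (8 * Real.pi) ^ (-(D : ℝ) / 2)
  -- Since `b t < 2 * r` on the chosen levels, the four bounds on `r` give, in order: a radius
  -- admissible in the ball estimate, `t < t₁`, `b t ≤ 1`, and `2 * r ^ 2 ≤ v₀`.
  refine ⟨F * E * c₁ * c₂, by positivity,
    min (min (ε₁ / 2) (b t₁ / 2)) (min (1 / 2) (√v₀ / 2)), by positivity, fun u hu hur => ?_⟩
  set r := ‖u - x₀‖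
  have hr : 0 < r := norm_sub_pos_iff.2 hu
  have hr1 : r < ε₁ / 2 := hur.trans_le ((min_le_left _ _).trans (min_le_left _ _))
  have hr2 : r < b t₁ / 2 := hur.trans_le ((min_le_left _ _).trans (min_le_right _ _))
  have hr3 : r < 1 / 2 := hur.trans_le ((min_le_right _ _).trans (min_le_left _ _))
  have hr4 : r < √v₀ / 2 := hur.trans_le ((min_le_right _ _).trans (min_le_right _ _))
  have hv : 2 * r ^ 2 ≤ v₀ := by
    have : r ^ 2 ≤ (√v₀ / 2) ^ 2 := by gcongr
    rw [div_pow, Real.sq_sqrt hv₀.le] at this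
    linarith
  set S := Icc 0 1 ∩ b ⁻¹' {s | s ^ 2 ∈ Ioo (r ^ 2) (2 * r ^ 2)}
  have hS : MeasurableSet S := by
    obtain ⟨O, hO, h⟩ := continuousOn_iff'.1 hb {s | s ^ 2 ∈ Ioo (r ^ 2) (2 * r ^ 2)}
      (isOpen_Ioo.preimage (continuous_pow 2))
    rw [show S = O ∩ Icc 0 1 by rw [← h, inter_comm]]
    exact hO.measurableSet.inter measurableSet_Icc
  have hpS : ENNReal.ofReal (c₂ * r ^ 2) ≤ priorLaw p S := by
    have := le_priorLaw_of_le_map hb hlow (sq_nonneg r) hv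
    rwa [show 2 * r ^ 2 - r ^ 2 = r ^ 2 by ring] at this
  set G := (2 * Real.pi * (2 * r) ^ 2) ^ (-(D : ℝ) / 2) * E * (c₁ * r ^ d)
  have hG : 0 ≤ G := by positivity
  have hLS : ∀ t ∈ S, ENNReal.ofReal G ≤ likelihood a b P u t := by
    rintro t ⟨ht, htr⟩
    have hbt : 0 ≤ b t := by
      rw [← hb_zero]
      exact hb_mono.monotoneOn (by simp) ht ht.1
    have hrb : r < b t := lt_of_pow_lt_pow_left₀ 2 hbt htr.1
    have hbr : b t < 2 * r := lt_of_pow_lt_pow_left₀ 2 (by positivity)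
      (htr.2.trans_le (by nlinarith [sq_nonneg r]))
    have htpos : 0 < t := by
      rcases ht.1.eq_or_lt with h | h
      · rw [← h, hb_zero] at hrb
        exact absurd hrb (not_lt.2 hr.le)
      · exact h
    have htt : t < t₁ := (hb_mono.lt_iff_lt ht ⟨ht₁.1.le, ht₁.2⟩).1 (by linarith)
    have haC := hat ⟨htpos, htt.trans ht₁₀⟩
    simp only [mem_ofPred_eq, Real.norm_eq_abs, abs_of_nonneg hbt] at haC
    refine le_likelihood (hr.trans hrb) (by linarith) hbr.le hC.le haC hrb.le
      (le_trans ?_ (hP (b t) ⟨hr.trans hrb, by linarith⟩))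
    apply ENNReal.ofReal_le_ofReal
    gcongr
  have hfinal : F * E * c₁ * c₂ / r ≤ G * (c₂ * r ^ 2) := by
    have h1 : (2 * Real.pi * (2 * r) ^ 2) ^ (-(D : ℝ) / 2) = F * (r ^ D)⁻¹ := by
      rw [show 2 * Real.pi * (2 * r) ^ 2 = (8 * Real.pi) * r ^ (2 : ℝ) by
          rw [Real.rpow_two]; ring,
        Real.mul_rpow (by positivity) (by positivity), ← Real.rpow_mul hr.le,
        ← Real.rpow_natCast r D, ← Real.rpow_neg hr.le]
      congr 2
      ring
    have h2 : r⁻¹ ≤ (r ^ D)⁻¹ * r ^ d * r ^ 2 := by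
      -- The codimension hypothesis enters here, as `d + 3 ≤ D` with `r < 1`.
      have h3 : r ^ D ≤ r ^ (d + 3) :=
        pow_le_pow_of_le_one hr.le (by linarith) (by omega)
      rw [mul_assoc, ← pow_add, inv_mul_eq_div, inv_eq_one_div,
        div_le_div_iff₀ hr (by positivity)]
      calc 1 * r ^ D ≤ r ^ (d + 3) := by rwa [one_mul]
        _ = _ := by ring
    calc F * E * c₁ * c₂ / r = F * E * c₁ * c₂ * r⁻¹ := by rw [div_eq_mul_inv]
      _ ≤ F * E * c₁ * c₂ * ((r ^ D)⁻¹ * r ^ d * r ^ 2) := by gcongr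
      _ = G * (c₂ * r ^ 2) := by simp only [G, h1]; ring
  calc ENNReal.ofReal (F * E * c₁ * c₂ / r) ≤ ENNReal.ofReal (G * (c₂ * r ^ 2)) :=
        ENNReal.ofReal_le_ofReal hfinal
    _ = ENNReal.ofReal G * ENNReal.ofReal (c₂ * r ^ 2) := ENNReal.ofReal_mul hG
    _ ≤ ENNReal.ofReal G * priorLaw p S := by gcongr
    _ = ∫⁻ _ in S, ENNReal.ofReal G ∂priorLaw p := (setLIntegral_const _ _).symm
    _ ≤ ∫⁻ t in S, likelihood a b P u t ∂priorLaw p := setLIntegral_mono' hS hLS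
    _ ≤ _ := setLIntegral_le_lintegral _ _

theorem evidence_pos [SFinite P] [NeZero P] [NeZero (priorLaw p)] (ha : ContinuousOn a (Icc 0 1))
    (hb : ContinuousOn b (Icc 0 1)) (hb_mono : StrictMonoOn b (Icc 0 1)) (hb_zero : b 0 = 0)
    (u : EuclideanSpace ℝ (Fin D)) : 0 < evidence a b P p u := by
  rw [pos_iff_ne_zero, evidence, Ne, lintegral_eq_zero_iff' (aemeasurable_likelihood ha hb u)]
  intro h
  have : ∀ᵐ t ∂priorLaw p, False := by
    filter_upwards [h, ae_priorLaw_mem_Ioc p] with t h0 ht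
    exact (likelihood_pos u (pos_of_strictMonoOn hb_mono hb_zero ht)).ne' h0
  rw [eventually_false_iff_eq_bot, ae_eq_bot] at this
  exact NeZero.ne _ this

theorem evidence_lt_top [IsProbabilityMeasure (priorLaw p)] {u : EuclideanSpace ℝ (Fin D)}
    {B : ℝ≥0∞} (hB : B ≠ ∞) (h : ∀ t ∈ Ioc (0 : ℝ) 1, likelihood a b P u t ≤ B) :
    evidence a b P p u < ∞ := by
  calc evidence a b P p u ≤ ∫⁻ _, B ∂priorLaw p :=
        lintegral_mono_ae ((ae_priorLaw_mem_Ioc p).mono h)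
    _ < ∞ := by simpa using hB.lt_top

theorem isProbabilityMeasure_posterior {u : EuclideanSpace ℝ (Fin D)}
    (h0 : evidence a b P p u ≠ 0) (h1 : evidence a b P p u ≠ ∞) :
    IsProbabilityMeasure (posterior a b P p u) := by
  constructor
  rw [posterior, Measure.smul_apply, withDensity_apply _ MeasurableSet.univ,
    Measure.restrict_univ, smul_eq_mul]
  exact ENNReal.inv_mul_cancel h0 h1

/-- The posterior mass of a set of noise levels that are bounded away from zero. -/
theorem posterior_le [IsProbabilityMeasure P] [IsProbabilityMeasure (priorLaw p)]
    (hb_mono : StrictMonoOn b (Icc 0 1)) (hb_zero : b 0 = 0) (u : EuclideanSpace ℝ (Fin D))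
    {δ : ℝ} (hδ : δ ∈ Ioc (0 : ℝ) 1) {F : Set ℝ} (hF : MeasurableSet F)
    (hFδ : ∀ t ∈ F, δ ≤ |t|) :
    posterior a b P p u F ≤ (evidence a b P p u)⁻¹ *
      ENNReal.ofReal ((2 * Real.pi * b δ ^ 2) ^ (-(D : ℝ) / 2)) := by
  rw [posterior, Measure.smul_apply, withDensity_apply _ hF, smul_eq_mul]
  gcongr
  calc _ ≤ ∫⁻ _ in F, ENNReal.ofReal ((2 * Real.pi * b δ ^ 2) ^ (-(D : ℝ) / 2)) ∂priorLaw p := by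
        apply lintegral_mono_ae
        filter_upwards [ae_restrict_mem hF, ae_restrict_of_ae (ae_priorLaw_mem_Ioc p)] with t htF ht
        refine likelihood_le u (pos_of_strictMonoOn hb_mono hb_zero hδ)
          (hb_mono.monotoneOn ⟨hδ.1.le, hδ.2⟩ ⟨ht.1.le, ht.2⟩ ?_)
        simpa [abs_of_pos ht.1] using hFδ t htF
    _ ≤ ∫⁻ _, ENNReal.ofReal ((2 * Real.pi * b δ ^ 2) ^ (-(D : ℝ) / 2)) ∂priorLaw p :=
        setLIntegral_le_lintegral _ _
    _ = _ := by simp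

/-- The posterior converges weakly to `δ₀` wherever the evidence tends to infinity. -/
theorem tendsto_posteriorProba [IsProbabilityMeasure P] [IsProbabilityMeasure (priorLaw p)]
    (hb_mono : StrictMonoOn b (Icc 0 1)) (hb_zero : b 0 = 0) {ι : Type*} {l : Filter ι}
    [l.IsCountablyGenerated] {u : ι → EuclideanSpace ℝ (Fin D)}
    (hpost : ∀ i, IsProbabilityMeasure (posterior a b P p (u i)))
    (hev : Tendsto (fun i => evidence a b P p (u i)) l (𝓝 ∞)) :
    Tendsto (fun i => posteriorProba a b P p (u i) (hpost i)) l (𝓝 (diracProba 0)) := by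
  -- Portmanteau criterion: a closed set containing `0` imposes nothing, and any other one stays
  -- away from `0`, so its posterior mass is controlled by the inverse evidence.
  refine tendsto_of_forall_isClosed_limsup_le' fun F hF => ?_
  by_cases h0 : (0 : ℝ) ∈ F
  · have h1 : ((diracProba (0 : ℝ) : ProbabilityMeasure ℝ) : Measure ℝ) F = 1 := by
      simp [diracProba, h0]
    rw [h1]
    exact limsup_le_of_le (h := Eventually.of_forall fun i =>
      (posteriorProba a b P p (u i) (hpost i)).2.measure_univ ▸ measure_mono (subset_univ F))
  · obtain ⟨ε, hε, hball⟩ := Metric.isOpen_iff.1 hF.isOpen_compl 0 h0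
    have hFδ : ∀ t ∈ F, min ε 1 ≤ |t| := by
      intro t ht
      by_contra! h
      exact hball (by simpa [Real.dist_eq] using h.trans_le (min_le_left _ _)) ht
    have hlim : Tendsto (fun i => (evidence a b P p (u i))⁻¹ *
        ENNReal.ofReal ((2 * Real.pi * b (min ε 1) ^ 2) ^ (-(D : ℝ) / 2))) l (𝓝 0) := by
      have h := ENNReal.Tendsto.mul_const (b := ENNReal.ofReal
        ((2 * Real.pi * b (min ε 1) ^ 2) ^ (-(D : ℝ) / 2)))
        (tendsto_inv_iff.2 hev) (Or.inr ENNReal.ofReal_ne_top)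
      simpa using h
    have hlim' : Tendsto (fun i => posterior a b P p (u i) F) l (𝓝 0) :=
      tendsto_of_tendsto_of_tendsto_of_le_of_le tendsto_const_nhds hlim (fun _ => zero_le)
        fun i => posterior_le hb_mono hb_zero (u i) ⟨by positivity, min_le_right _ _⟩
          hF.measurableSet hFδ
    rcases l.eq_or_neBot with rfl | hl
    · simp
    · exact (hlim'.limsup_eq.le).trans (zero_le)

theorem eventually_le_evidence {x₀ : EuclideanSpace ℝ (Fin D)}
    (h : ∃ c : ℝ, 0 < c ∧ ∃ ε : ℝ, 0 < ε ∧ ∀ u, u ≠ x₀ → ‖u - x₀‖ < ε →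
      ENNReal.ofReal (c / ‖u - x₀‖) ≤ evidence a b P p u) (N : ℝ≥0) :
    ∀ᶠ u in 𝓝 x₀, u ≠ x₀ → N < evidence a b P p u := by
  obtain ⟨c, hc, ε, hε, h⟩ := h
  have hN : (0 : ℝ) < N + 1 := by positivity
  -- Within `c / (N + 1)` of `x₀` the lower bound `c / ‖u - x₀‖` exceeds `N + 1`.
  filter_upwards [Metric.ball_mem_nhds x₀ (show 0 < min ε (c / (N + 1)) by positivity)] with u hu hne
  rw [Metric.mem_ball, dist_eq_norm] at hu
  refine lt_of_lt_of_le ?_ (h u hne (hu.trans_le (min_le_left _ _)))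
  rw [← ENNReal.ofReal_coe_nnreal, ENNReal.ofReal_lt_ofReal_iff_of_nonneg N.coe_nonneg,
    lt_div_iff₀ (norm_sub_pos_iff.2 hne)]
  have := hu.trans_le (min_le_right _ _)
  rw [lt_div_iff₀ hN] at this
  nlinarith [norm_nonneg (u - x₀)]

end Posterior

/-! ### The main theorem. -/

theorem mainTheorem3 (d D : ℕ) (hcodim : d + 2 < D)
    (M : Set (EuclideanSpace ℝ (Fin D))) (hM : IsC2Submanifold d M)
    -- the data density, continuous and bounded on `M`
    (q : EuclideanSpace ℝ (Fin D) → ℝ) (hq_cont : ContinuousOn q M)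
    (hq_nonneg : ∀ x ∈ M, 0 ≤ q x) (hq_bdd : ∃ B : ℝ, ∀ x ∈ M, q x ≤ B)
    (hq_prob : IsProbabilityMeasure (dataLaw d M q))
    -- the schedule
    (a b : ℝ → ℝ) (ha_cont : ContinuousOn a (Icc 0 1)) (hb_cont : ContinuousOn b (Icc 0 1))
    (hb_mono : StrictMonoOn b (Icc 0 1)) (hb_zero : b 0 = 0)
    (hab : (fun t => a t - 1) =O[𝓝[>] 0] b)
    -- the prior density of the noise level `t`; the induced law of the variance `b(t)²` has density
    -- bounded below near zero
    (p : ℝ → ℝ) (hp_meas : AEMeasurable p (volume.restrict (Icc 0 1)))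
    (hp_nonneg : ∀ t ∈ Icc (0 : ℝ) 1, 0 ≤ p t)
    (hp_prob : IsProbabilityMeasure (priorLaw p))
    (hp_low : DensityBoundedBelowNearZero ((priorLaw p).map (fun t => b t ^ 2))) :
    -- off the closure of `M` the posterior is a genuine probability measure, and
    ∃ hpost : ∀ u : {u : EuclideanSpace ℝ (Fin D) // 0 < Metric.infDist u M},
        IsProbabilityMeasure (posterior a b (dataLaw d M q) p u.1),
      -- it converges weakly to `δ₀` as `dist(u, M) → 0` if `M` is compact with positive density,
      (IsCompact M → (∀ x ∈ M, 0 < q x) →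
        Tendsto (fun u : {u // 0 < Metric.infDist u M} =>
            posteriorProba a b (dataLaw d M q) p u.1 (hpost u))
          (comap (fun u => Metric.infDist u.1 M) (𝓝 0)) (𝓝 (diracProba 0))) ∧
      -- and, for general `M`, as `u` approaches a compact piece of `M` with positive density.
      (∀ K : Set (EuclideanSpace ℝ (Fin D)), K ⊆ M → K.Nonempty → IsCompact K →
        (∀ x ∈ K, 0 < q x) →
        Tendsto (fun u : {u // 0 < Metric.infDist u M} =>
            posteriorProba a b (dataLaw d M q) p u.1 (hpost u))
          (comap (fun u => Metric.infDist u.1 K) (𝓝 0)) (𝓝 (diracProba 0))) := by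
  have haM : ∀ᵐ x ∂dataLaw d M q, x ∈ M := by
    obtain ⟨A, B, hA, hB, hAB⟩ := hM.isLocallyClosed
    have hmeas : MeasurableSet M := hAB ▸ hA.measurableSet.inter hB.measurableSet
    exact (withDensity_absolutelyContinuous _ _).ae_le (ae_restrict_mem hmeas)
  have ha_one : Tendsto a (𝓝[>] 0) (𝓝 1) := by
    have hb0 : Tendsto b (𝓝[>] 0) (𝓝 0) := by
      have h := hb_cont 0 (by simp)
      rw [ContinuousWithinAt, hb_zero] at h
      refine h.mono_left ?_
      rw [← nhdsWithin_Ioc_eq_nhdsGT one_pos]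
      exact nhdsWithin_mono _ Ioc_subset_Icc_self
    simpa using (hab.trans_tendsto hb0).add_const 1
  have hpost : ∀ u : {u : EuclideanSpace ℝ (Fin D) // 0 < Metric.infDist u M},
      IsProbabilityMeasure (posterior a b (dataLaw d M q) p u.1) := by
    intro u
    obtain ⟨B, hB, h⟩ := exists_likelihood_le haM hb_mono hb_zero ha_one u.2
    exact isProbabilityMeasure_posterior
      (evidence_pos ha_cont hb_cont hb_mono hb_zero u.1).ne' (evidence_lt_top hB h).ne
  have hK : ∀ K : Set (EuclideanSpace ℝ (Fin D)), K ⊆ M → K.Nonempty → IsCompact K →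
      (∀ x ∈ K, 0 < q x) →
      Tendsto (fun u : {u // 0 < Metric.infDist u M} =>
          posteriorProba a b (dataLaw d M q) p u.1 (hpost u))
        (comap (fun u => Metric.infDist u.1 K) (𝓝 0)) (𝓝 (diracProba 0)) := by
    intro K hKM hKne hKc hKq
    refine tendsto_posteriorProba hb_mono hb_zero hpost (ENNReal.tendsto_nhds_top fun N => ?_)
    -- The constants at different points of `K` need no comparison: for fixed `N` the local
    -- neighbourhoods form an open set around `K`, which by compactness contains a thickening of
    -- `K`.
    have hnhds : ∀ᶠ u in 𝓝ˢ K, 0 < Metric.infDist u M → N < evidence a b (dataLaw d M q) p u := by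
      refine eventually_nhdsSet_iff_forall.2 fun x hx => ?_
      filter_upwards [eventually_le_evidence (exists_le_evidence hcodim hb_cont hb_mono hb_zero hab
        hp_low (hM.exists_le_dataLaw_ball hq_cont (hKM hx) (hKq x hx))) N] with u hu hpos
      refine hu ?_
      rintro rfl
      exact hpos.ne' (Metric.infDist_zero_of_mem (hKM hx))
    obtain ⟨O, hO, hKO, hON⟩ := eventually_nhdsSet_iff_exists.1 hnhds
    obtain ⟨δ, hδ, hthick⟩ := hKc.exists_thickening_subset_open hO hKO
    filter_upwards [preimage_mem_comap (Iio_mem_nhds hδ)] with u hu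
    exact hON u.1 (hthick ((Metric.mem_thickening_iff_infDist_lt hKne).2 hu)) u.2
  refine ⟨hpost, fun hMc hMq => hK M Subset.rfl ?_ hMc hMq, hK⟩
  -- `M` is nonempty because it carries a probability measure.
  exact (haM.exists).imp fun _ h => h
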